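/- All graphs are finite, simple and connected, with at least two vertices. A set $X$ of vertices of $G$ is a nonlocal resolving set if for any two distinct non-adjacent vertices $u,v$ of $G$ there is $x\in X$ with $d_G(u,x)\neq d_G(v,x)$; the nonlocal metric dimension $\dim_{\mathrm{n}\ell}(G)$ is the smallest cardinality of a nonlocal resolving set. The edge cover number $\beta'(G)$ is the smallest number of edges of $G$ such that each vertex of $G$ is incident with at least one of them. Theorem. If $G$ is a graph of girth at least $7$ (where an acyclic graph has girth $\infty$), then $$\dim_{\mathrm{n}\ell}(G)\le \beta'(G)-1.$$ Moreover, if $G$ is a tree, then equality $\dim_{\mathrm{n}\ell}(G)=\beta'(G)-1$ holds if and only if $G$ is obtained from a star $K_{1,m}$, $m\ge 1$, by subdividing all but one of its edges at most once; that is, some edge of the star is left unsubdivided, and each of the other edges is either left unsubdivided or subdivided exactly once. -/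

import Mathlib

namespace SimpleGraph

/-- `X` is a nonlocal resolving set of `G`: every two distinct non-adjacent vertices `u`, `v`
are resolved by some `x ∈ X`, that is, `d(u, x) ≠ d(v, x)`. -/
def IsNonlocalResolvingSet {V : Type*} (G : SimpleGraph V) (X : Finset V) : Prop :=
  ∀ u v : V, u ≠ v → ¬ G.Adj u v → ∃ x ∈ X, G.dist u x ≠ G.dist v x

/-- The nonlocal metric dimension: the least cardinality of a nonlocal resolving set. (In a finite
connected graph the set of all vertices is a nonlocal resolving set.) -/
noncomputable def nonlocalMetricDim {V : Type*} (G : SimpleGraph V) : ℕ :=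
  sInf {k : ℕ | ∃ X : Finset V, G.IsNonlocalResolvingSet X ∧ X.card = k}

/-- `S` is an edge cover of `G`: a set of edges such that each vertex is incident with
at least one of them. -/
def IsEdgeCoverSet {V : Type*} (G : SimpleGraph V) (S : Finset (Sym2 V)) : Prop :=
  (∀ e ∈ S, e ∈ G.edgeSet) ∧ ∀ v : V, ∃ e ∈ S, v ∈ e

/-- The edge cover number: the least cardinality of an edge cover. (A finite graph without
isolated vertices has an edge cover, namely the set of all its edges.) -/
noncomputable def edgeCoverNum {V : Type*} (G : SimpleGraph V) : ℕ :=
  sInf {k : ℕ | ∃ S : Finset (Sym2 V), G.IsEdgeCoverSet S ∧ S.card = k}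

/-- The graph obtained from `H` by subdividing exactly once each edge that belongs to `F` and
leaving all the other edges as they are. The vertices are those of `H`, together with one new
vertex for each `e ∈ F`, which is adjacent precisely to the two ends of `e`. -/
def subdivide {W : Type*} (H : SimpleGraph W) (F : Set (Sym2 W)) :
    SimpleGraph (W ⊕ {e : Sym2 W // e ∈ F ∧ e ∈ H.edgeSet}) where
  Adj
    | Sum.inl u, Sum.inl v => H.Adj u v ∧ s(u, v) ∉ F
    | Sum.inl u, Sum.inr e => u ∈ e.1
    | Sum.inr e, Sum.inl u => u ∈ e.1
    | Sum.inr _, Sum.inr _ => False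
  symm := ⟨by
    rintro (u | e) (v | f) h
    · exact ⟨h.1.symm, fun hF => h.2 (Sym2.eq_swap ▸ hF)⟩
    · exact h
    · exact h
    · exact h⟩
  loopless := ⟨by
    rintro (u | e) h
    · exact H.loopless.irrefl u h.1
    · exact h⟩

/-- `G` is obtained (up to isomorphism) from a star `K_{1,m}` by subdividing all but one of its edges at most
once: one edge `e₀` of the star is left as it is, and each of the others is
either left as it is or subdivided exactly once. -/
def IsStarSubdividedAllButOneAtMostOnce {V : Type*} (G : SimpleGraph V) : Prop :=
  ∃ (m : ℕ) (e₀ : Sym2 (Fin (m + 1))) (F : Set (Sym2 (Fin (m + 1)))),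
    e₀ ∈ (starGraph (0 : Fin (m + 1))).edgeSet ∧ F ⊆ (starGraph (0 : Fin (m + 1))).edgeSet \ {e₀} ∧
      Nonempty (G ≃g (starGraph (0 : Fin (m + 1))).subdivide F)

end SimpleGraph

/-!
Every edge of a minimum edge cover `S` has a private end, covered by no other edge of `S`. Drop one
edge `e₀` and let `X` consist of private ends of the other edges. If girth exceeds `4`, two vertices
have at most one common neighbour, so the private end of an edge resolves the other end from almost
everything. If two edges of `S` share an end, choose `e₀` among them: the path of length three
through the shared end is the unique shortest one as the girth exceeds `6`, and it resolves the
remaining pairs. If `S` is a matching, choose the private ends not adjacent to `e₀` instead.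

In a tree, `X` is a nonlocal resolving set if and only if it meets one of any two branches at any
vertex. Hence all end vertices but one form such a set, and so do all but two if two major vertices
have end vertices as neighbours. End vertices need pairwise distinct covering edges, so equality
forces every vertex to be an end vertex or next to one, and leaves room for at most one major
vertex; this is a star with some of its edges subdivided once. Conversely, a nonlocal resolving set
misses at most one branch at the centre of such a star, which gives the lower bound.
-/

namespace NonlocalMetricDim

open SimpleGraph

variable {V : Type*} {G : SimpleGraph V} {a b c s u v w x y z : V}

/-! ### Short paths in graphs of large girth -/

lemma eq_of_length_add_length_lt_egirth {p q : G.Walk u v} (hp : p.IsPath) (hq : q.IsPath)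
    (h : ((p.length + q.length : ℕ) : ℕ∞) < G.egirth) : p = q := by
  by_contra hne
  obtain ⟨w, -, -, c, hc, hle⟩ := hp.exists_isCycle_length_le_add_of_ne hq hne
  exact h.not_ge (hc.egirth_le_length.trans (mod_cast hle))

lemma length_eq_dist_of_two_mul_length_lt_egirth {p : G.Walk u v} (hp : p.IsPath)
    (h : ((2 * p.length : ℕ) : ℕ∞) < G.egirth) : p.length = G.dist u v := by
  obtain ⟨q, hq⟩ := p.reachable.exists_walk_length_eq_dist
  have hle : q.length ≤ p.length := hq ▸ dist_le p
  rw [eq_of_length_add_length_lt_egirth hp (q.isPath_of_length_eq_dist hq)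
    (lt_of_le_of_lt (by gcongr; omega) h), hq]

lemma length_le_dist_of_adj_of_ne {h : G.Adj u w} {p : G.Walk w x} (hp : (p.cons h).IsPath)
    (hlt : ((2 * (p.cons h).length : ℕ) : ℕ∞) < G.egirth) (huv : G.Adj u v) (hvw : v ≠ w) :
    (p.cons h).length ≤ G.dist v x := by
  by_contra! hdist
  obtain ⟨q, hq⟩ := (huv.symm.reachable.trans (p.cons h).reachable).exists_walk_length_eq_dist
  have hu : u ∉ q.support := fun hu => by
    classical
    have := length_eq_dist_of_two_mul_length_lt_egirth hp hlt
    have := dist_le (q.dropUntil u hu)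
    have := q.length_dropUntil_le_length hu
    omega
  have hqp : (q.cons huv).IsPath := (q.isPath_of_length_eq_dist hq).cons hu
  have heq : q.cons huv = p.cons h := eq_of_length_add_length_lt_egirth hqp hp
    (lt_of_le_of_lt (by gcongr; rw [Walk.length_cons]; omega) hlt)
  exact hvw (by simpa using congrArg Walk.snd heq)

lemma not_adj_of_adj_of_adj (h : 3 < G.egirth) (huv : G.Adj u v) (hvw : G.Adj v w) :
    ¬ G.Adj u w := fun huw => by
  have hp : (Walk.cons huv (Walk.cons hvw .nil)).IsPath := by
    simp [Walk.isPath_def, huv.ne, huw.ne, hvw.ne]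
  have hq : (Walk.cons huw .nil).IsPath := by simp [Walk.isPath_def, huw.ne]
  simpa using congrArg Walk.length (eq_of_length_add_length_lt_egirth hp hq h)

lemma eq_of_adj_common (h : 4 < G.egirth) (huv : u ≠ v) (hux : G.Adj u x) (hxv : G.Adj x v)
    (huy : G.Adj u y) (hyv : G.Adj y v) : x = y := by
  have hp : (Walk.cons hux (Walk.cons hxv .nil)).IsPath := by
    simp [Walk.isPath_def, hux.ne, huv, hxv.ne]
  have hq : (Walk.cons huy (Walk.cons hyv .nil)).IsPath := by
    simp [Walk.isPath_def, huy.ne, huv, hyv.ne]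
  exact congrArg Walk.snd (eq_of_length_add_length_lt_egirth hp hq h)

lemma dist_ne_or_dist_ne_of_adj (h : 4 < G.egirth) (huv : u ≠ v) (hux : G.Adj u x)
    (hvy : G.Adj v y) (hxy : x ≠ y) : G.dist u x ≠ G.dist v x ∨ G.dist u y ≠ G.dist v y := by
  by_contra! hdist
  rw [dist_eq_one_iff_adj.mpr hux, dist_eq_one_iff_adj.mpr hvy] at hdist
  exact hxy (eq_of_adj_common h huv hux (dist_eq_one_iff_adj.mp hdist.1.symm).symm
    (dist_eq_one_iff_adj.mp hdist.2) hvy.symm)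

lemma exists_mem_forall_not_adj (h : 4 < G.egirth) {e f : Sym2 V} (he : e ∈ G.edgeSet)
    (hf : f ∈ G.edgeSet) (hdisj : ∀ x ∈ e, x ∉ f) : ∃ x ∈ e, ∀ y ∈ f, ¬ G.Adj x y := by
  have h3 : 3 < G.egirth := lt_trans (by norm_num) h
  induction e with | _ a b
  by_contra! hcon
  obtain ⟨x, hx, hax⟩ := hcon a (Sym2.mem_mk_left a b)
  obtain ⟨y, hy, hby⟩ := hcon b (Sym2.mem_mk_right a b)
  by_cases hxy : x = y
  · exact not_adj_of_adj_of_adj h3 he (hxy ▸ hby) hax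
  · obtain rfl : f = s(x, y) := (Sym2.mem_and_mem_iff hxy).mp ⟨hx, hy⟩
    have hay : a ≠ y := fun hay => hdisj a (Sym2.mem_mk_left a b) (hay ▸ hy)
    have hbx : b = x := eq_of_adj_common h hay he hby hax hf
    exact hdisj b (Sym2.mem_mk_right a b) (hbx ▸ hx)

lemma dist_ne_dist_of_adj_of_path (h : 6 < G.egirth) (hxz : G.Adj x z) (hzc : G.Adj z c)
    (hcy : G.Adj c y) (hxc : x ≠ c) (hxy : x ≠ y) (hzy : z ≠ y) (hxv : G.Adj x v) (hvz : v ≠ z) :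
    G.dist z y ≠ G.dist v y := by
  have hpath : (Walk.cons hxz (Walk.cons hzc (Walk.cons hcy .nil))).IsPath := by
    simp [Walk.isPath_def, hxz.ne, hzc.ne, hcy.ne, hxc, hxy, hzy]
  have hfar : 3 ≤ G.dist v y := length_le_dist_of_adj_of_ne hpath h hxv hvz
  have hnear : G.dist z y ≤ 2 := dist_le (.cons hzc (.cons hcy .nil))
  omega

/-! ### Edge covers and private ends -/

lemma nonlocalMetricDim_le {X : Finset V} (hX : G.IsNonlocalResolvingSet X) :
    G.nonlocalMetricDim ≤ X.card :=
  Nat.sInf_le ⟨X, hX, rfl⟩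

lemma edgeCoverNum_le {S : Finset (Sym2 V)} (hS : G.IsEdgeCoverSet S) :
    G.edgeCoverNum ≤ S.card :=
  Nat.sInf_le ⟨S, hS, rfl⟩

lemma dist_self_ne_dist (hG : G.Connected) (huv : u ≠ v) : G.dist u u ≠ G.dist v u := by
  rw [dist_self]
  exact (hG.pos_dist_of_ne huv.symm).ne

lemma exists_isNonlocalResolvingSet_card_eq [Finite V] (hG : G.Connected) :
    ∃ X : Finset V, G.IsNonlocalResolvingSet X ∧ X.card = G.nonlocalMetricDim :=
  have := Fintype.ofFinite V
  Nat.sInf_mem (s := {k | ∃ X : Finset V, G.IsNonlocalResolvingSet X ∧ X.card = k})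
    ⟨_, Finset.univ, fun u _ huv _ => ⟨u, Finset.mem_univ u, dist_self_ne_dist hG huv⟩, rfl⟩

lemma exists_isEdgeCoverSet_card_eq [Finite V] (hG : ∀ v, ∃ w, G.Adj v w) :
    ∃ S : Finset (Sym2 V), G.IsEdgeCoverSet S ∧ S.card = G.edgeCoverNum := by
  have hcover : ∀ v, ∃ e ∈ G.edgeSet.toFinite.toFinset, v ∈ e := fun v => by
    obtain ⟨w, hvw⟩ := hG v
    exact ⟨s(v, w), by simpa using hvw, Sym2.mem_mk_left v w⟩
  exact Nat.sInf_mem (s := {k | ∃ S : Finset (Sym2 V), G.IsEdgeCoverSet S ∧ S.card = k})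
    ⟨_, _, ⟨fun e he => by simpa using he, hcover⟩, rfl⟩

lemma eq_of_mem_of_ne_of_ne {e : Sym2 V} (hx : x ∈ e) (hu : u ∈ e) (hv : v ∈ e) (hux : u ≠ x)
    (hvx : v ≠ x) : u = v := by
  rw [(Sym2.mem_and_mem_iff hux).mp ⟨hu, hx⟩, Sym2.mem_iff] at hv
  exact (hv.resolve_right hvx).symm

/-- `p` picks an end of each edge of `S` that lies on no other edge of `S`. Such a choice of
private ends exists when `S` is a minimum edge cover, and also when `S` is a matching. -/
def IsPrivateEnd (S : Finset (Sym2 V)) (p : Sym2 V → V) : Prop :=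
  ∀ e ∈ S, p e ∈ e ∧ ∀ f ∈ S, p e ∈ f → f = e

lemma exists_isPrivateEnd [Nonempty V] {S : Finset (Sym2 V)} (hS : G.IsEdgeCoverSet S)
    (hcard : S.card ≤ G.edgeCoverNum) : ∃ p, IsPrivateEnd S p := by
  classical
  suffices h : ∀ e ∈ S, ∃ x ∈ e, ∀ f ∈ S, x ∈ f → f = e by
    choose! p hpe hp using h
    exact ⟨p, fun e he => ⟨hpe e he, hp e he⟩⟩
  intro e he
  by_contra! hcon
  have hcover : G.IsEdgeCoverSet (S.erase e) := by
    refine ⟨fun f hf => hS.1 f (Finset.mem_of_mem_erase hf), fun v => ?_⟩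
    obtain ⟨f, hf, hvf⟩ := hS.2 v
    by_cases hfe : f = e
    · obtain ⟨g, hg, hvg, hge⟩ := hcon v (hfe ▸ hvf)
      exact ⟨g, Finset.mem_erase.mpr ⟨hge, hg⟩, hvg⟩
    · exact ⟨f, Finset.mem_erase.mpr ⟨hfe, hf⟩, hvf⟩
  have := edgeCoverNum_le hcover
  have := Finset.card_erase_lt_of_mem he
  omega

lemma adj_of_isPrivateEnd {S : Finset (Sym2 V)} {p : Sym2 V → V} (hS : G.IsEdgeCoverSet S)
    (hp : IsPrivateEnd S p) {e : Sym2 V} (he : e ∈ S) (hve : v ∈ e) (hvp : v ≠ p e) :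
    G.Adj v (p e) :=
  adj_iff_exists_edge.mpr ⟨hvp, e, hS.1 e he, hve, (hp e he).1⟩

lemma dist_ne_or_dist_ne_of_isPrivateEnd (hg : 4 < G.egirth) {S : Finset (Sym2 V)}
    {p : Sym2 V → V} (hS : G.IsEdgeCoverSet S) (hp : IsPrivateEnd S p) (huv : u ≠ v)
    (hadj : ¬ G.Adj u v) {e f : Sym2 V} (he : e ∈ S) (hf : f ∈ S) (hue : u ∈ e) (hvf : v ∈ f)
    (hup : u ≠ p e) (hvp : v ≠ p f) :
    G.dist u (p e) ≠ G.dist v (p e) ∨ G.dist u (p f) ≠ G.dist v (p f) := by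
  refine dist_ne_or_dist_ne_of_adj hg huv (adj_of_isPrivateEnd hS hp he hue hup)
    (adj_of_isPrivateEnd hS hp hf hvf hvp) fun hpef => hadj ?_
  obtain rfl : f = e := (hp e he).2 f hf (hpef ▸ (hp f hf).1)
  exact adj_iff_exists_edge.mpr ⟨huv, f, hS.1 f hf, hue, hvf⟩

lemma isNonlocalResolvingSet_of_forall_notMem {X : Finset V} (hG : G.Connected)
    (h : ∀ u ∉ X, ∀ v ∉ X, u ≠ v → ¬ G.Adj u v → ∃ x ∈ X, G.dist u x ≠ G.dist v x) :
    G.IsNonlocalResolvingSet X := by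
  intro u v huv hadj
  by_cases hu : u ∈ X
  · exact ⟨u, hu, dist_self_ne_dist hG huv⟩
  by_cases hv : v ∈ X
  · exact ⟨v, hv, (dist_self_ne_dist hG huv.symm).symm⟩
  exact h u hu v hv huv hadj

/-- Two covered vertices are resolved by the private ends of their edges, and the uncovered
vertices are ends of `e₀`, so only the mixed pairs are left to the hypothesis. -/
lemma isNonlocalResolvingSet_image_erase [DecidableEq V] (hG : G.Connected) (hg : 4 < G.egirth)
    {S : Finset (Sym2 V)} (hS : G.IsEdgeCoverSet S) {p : Sym2 V → V} (hp : IsPrivateEnd S p)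
    {e₀ : Sym2 V} (h : ∀ u ∈ e₀, (∀ e ∈ S.erase e₀, u ∉ e) → ∀ e ∈ S.erase e₀, ∀ v ∈ e,
      v ≠ p e → ¬ G.Adj u v → ∃ x ∈ (S.erase e₀).image p, G.dist u x ≠ G.dist v x) :
    G.IsNonlocalResolvingSet ((S.erase e₀).image p) := by
  have hend : ∀ w, (∀ e ∈ S.erase e₀, w ∉ e) → w ∈ e₀ ∧ e₀ ∈ S := fun w hw => by
    obtain ⟨e, he, hwe⟩ := hS.2 w
    obtain rfl : e = e₀ := by_contra fun hee₀ => hw e (Finset.mem_erase.mpr ⟨hee₀, he⟩) hwe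
    exact ⟨hwe, he⟩
  have hne : ∀ w ∉ (S.erase e₀).image p, ∀ e ∈ S.erase e₀, w ≠ p e := fun w hw e he hwe =>
    hw (hwe ▸ Finset.mem_image_of_mem p he)
  refine isNonlocalResolvingSet_of_forall_notMem hG fun u hu v hv huv hadj => ?_
  by_cases hcu : ∀ e ∈ S.erase e₀, u ∉ e <;> by_cases hcv : ∀ f ∈ S.erase e₀, v ∉ f
  · exact absurd (adj_iff_exists_edge.mpr
      ⟨huv, e₀, hS.1 e₀ (hend u hcu).2, (hend u hcu).1, (hend v hcv).1⟩) hadj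
  · push Not at hcv
    obtain ⟨f, hf, hvf⟩ := hcv
    exact h u (hend u hcu).1 hcu f hf v hvf (hne v hv f hf) hadj
  · push Not at hcu
    obtain ⟨e, he, hue⟩ := hcu
    obtain ⟨x, hx, hdist⟩ :=
      h v (hend v hcv).1 hcv e he u hue (hne u hu e he) fun hvu => hadj hvu.symm
    exact ⟨x, hx, hdist.symm⟩
  · push Not at hcu hcv
    obtain ⟨⟨e, he, hue⟩, f, hf, hvf⟩ := And.intro hcu hcv
    rcases dist_ne_or_dist_ne_of_isPrivateEnd hg hS hp huv hadj (Finset.mem_of_mem_erase he)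
      (Finset.mem_of_mem_erase hf) hue hvf (hne u hu e he) (hne v hv f hf) with hdist | hdist
    · exact ⟨_, Finset.mem_image_of_mem p he, hdist⟩
    · exact ⟨_, Finset.mem_image_of_mem p hf, hdist⟩

lemma isNonlocalResolvingSet_of_mem_of_mem [DecidableEq V] (hG : G.Connected)
    (hg : 6 < G.egirth) {S : Finset (Sym2 V)} (hS : G.IsEdgeCoverSet S) {p : Sym2 V → V}
    (hp : IsPrivateEnd S p) {e₀ e₁ : Sym2 V} (he₀ : e₀ ∈ S) (he₁ : e₁ ∈ S) (hne : e₀ ≠ e₁)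
    (hc₀ : c ∈ e₀) (hc₁ : c ∈ e₁) :
    G.IsNonlocalResolvingSet ((S.erase e₀).image p) := by
  have hcp : ∀ e ∈ S, c ≠ p e := fun e he hce =>
    hne (((hp e he).2 e₀ he₀ (hce ▸ hc₀)).trans ((hp e he).2 e₁ he₁ (hce ▸ hc₁)).symm)
  have hinj : ∀ e ∈ S, ∀ f ∈ S, p e = p f → e = f := fun e he f hf hef =>
    (hp f hf).2 e he (hef ▸ (hp e he).1)
  have he₁' : e₁ ∈ S.erase e₀ := Finset.mem_erase.mpr ⟨hne.symm, he₁⟩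
  have hcz : G.Adj c (p e₀) := adj_of_isPrivateEnd hS hp he₀ hc₀ (hcp e₀ he₀)
  have hcy : G.Adj c (p e₁) := adj_of_isPrivateEnd hS hp he₁ hc₁ (hcp e₁ he₁)
  refine isNonlocalResolvingSet_image_erase hG (lt_trans (by norm_num) hg) hS hp
    fun u hu hcu e he v hve hvp huv => ?_
  have heS := Finset.mem_of_mem_erase he
  obtain rfl : u = p e₀ := eq_of_mem_of_ne_of_ne hc₀ hu (hp e₀ he₀).1
    (fun huc => hcu e₁ he₁' (huc ▸ hc₁)) (hcp e₀ he₀).symm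
  by_contra! hdist
  have hvx : G.Adj v (p e) := adj_of_isPrivateEnd hS hp heS hve hvp
  have hzx : G.Adj (p e₀) (p e) := dist_eq_one_iff_adj.mp
    ((hdist _ (Finset.mem_image_of_mem p he)).trans (dist_eq_one_iff_adj.mpr hvx))
  have hxy : p e ≠ p e₁ := fun hxy => by
    obtain rfl := hinj e heS e₁ he₁ hxy
    have hvc : v = c := eq_of_mem_of_ne_of_ne (hp e he₁).1 hve hc₁ hvp (hcp e he₁)
    exact huv (hvc ▸ hcz.symm)
  exact dist_ne_dist_of_adj_of_path hg hzx.symm hcz.symm hcy (hcp e heS).symm hxy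
    (fun hzy => hne (hinj e₀ he₀ e₁ he₁ hzy)) hvx.symm (fun hvz => hcu e he (hvz ▸ hve))
    (hdist _ (Finset.mem_image_of_mem p he₁'))

lemma isNonlocalResolvingSet_of_forall_not_adj [DecidableEq V] (hG : G.Connected)
    (hg : 4 < G.egirth) {S : Finset (Sym2 V)} (hS : G.IsEdgeCoverSet S) {p : Sym2 V → V}
    (hp : IsPrivateEnd S p) {e₀ : Sym2 V}
    (h : ∀ e ∈ S.erase e₀, ∀ x ∈ e₀, ¬ G.Adj x (p e)) :
    G.IsNonlocalResolvingSet ((S.erase e₀).image p) := by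
  refine isNonlocalResolvingSet_image_erase hG hg hS hp fun u hu _ e he v hve hvp _ =>
    ⟨p e, Finset.mem_image_of_mem p he, fun hdist => h e he u hu ?_⟩
  exact dist_eq_one_iff_adj.mp (hdist.trans (dist_eq_one_iff_adj.mpr
    (adj_of_isPrivateEnd hS hp (Finset.mem_of_mem_erase he) hve hvp)))

theorem nonlocalMetricDim_add_one_le_edgeCoverNum [Finite V] [Nontrivial V] (hG : G.Connected)
    (hg : 6 < G.egirth) : G.nonlocalMetricDim + 1 ≤ G.edgeCoverNum := by
  classical
  have hg4 : 4 < G.egirth := lt_trans (by norm_num) hg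
  obtain ⟨S, hS, hcard⟩ :=
    exists_isEdgeCoverSet_card_eq hG.preconnected.exists_adj_of_nontrivial
  suffices h : ∃ e₀ ∈ S, ∃ p, G.IsNonlocalResolvingSet ((S.erase e₀).image p) by
    obtain ⟨e₀, he₀, p, hX⟩ := h
    have := nonlocalMetricDim_le hX
    have := Finset.card_image_le (s := S.erase e₀) (f := p)
    have := Finset.card_erase_add_one he₀
    omega
  by_cases hmatch : ∀ e ∈ S, ∀ f ∈ S, ∀ x ∈ e, x ∈ f → e = f
  · obtain ⟨e₀, he₀, -⟩ := hS.2 (Classical.arbitrary V)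
    have hfar : ∀ e ∈ S, ∃ x ∈ e, e ≠ e₀ → ∀ y ∈ e₀, ¬ G.Adj x y := fun e he => by
      by_cases hee₀ : e = e₀
      · exact ⟨_, e.out_fst_mem, fun h => absurd hee₀ h⟩
      · obtain ⟨x, hx, hxy⟩ := exists_mem_forall_not_adj hg4 (hS.1 e he) (hS.1 e₀ he₀)
          fun x hx hx₀ => hee₀ (hmatch e he e₀ he₀ x hx hx₀)
        exact ⟨x, hx, fun _ => hxy⟩
    choose! p hpe hp using hfar
    have hpriv : IsPrivateEnd S p :=
      fun e he => ⟨hpe e he, fun f hf hef => hmatch f hf e he _ hef (hpe e he)⟩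
    refine ⟨e₀, he₀, p, isNonlocalResolvingSet_of_forall_not_adj hG hg4 hS hpriv
      fun e he x hx hadj => ?_⟩
    exact hp e (Finset.mem_of_mem_erase he) (Finset.ne_of_mem_erase he) x hx hadj.symm
  · push Not at hmatch
    obtain ⟨e₀, he₀, e₁, he₁, c, hc₀, hc₁, hne⟩ := hmatch
    obtain ⟨p, hp⟩ := exists_isPrivateEnd hS hcard.le
    exact ⟨e₀, he₀, p, isNonlocalResolvingSet_of_mem_of_mem hG hg hS hp he₀ he₁ hne hc₀ hc₁⟩

/-! ### Branches of trees -/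

/-- The vertices closer to `a` than to its neighbour `w`. In a tree this is the component of `a`
after the deletion of the edge `wa`. -/
def branch (G : SimpleGraph V) (w a : V) : Set V := {x | G.dist w x = G.dist a x + 1}

lemma mem_branch : x ∈ branch G w a ↔ G.dist w x = G.dist a x + 1 := Iff.rfl

lemma mem_branch_self (hwa : G.Adj w a) : a ∈ branch G w a := by
  rw [mem_branch, dist_self, dist_eq_one_iff_adj.mpr hwa]

lemma exists_adj_mem_branch (hG : G.Connected) (hwx : w ≠ x) :
    ∃ a, G.Adj w a ∧ x ∈ branch G w a := by
  obtain ⟨p, hp⟩ := hG.exists_walk_length_eq_dist w x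
  cases p with
  | nil => exact absurd rfl hwx
  | @cons _ a _ hwa p =>
    refine ⟨a, hwa, ?_⟩
    have := dist_le p
    have := hG.dist_triangle (u := w) (v := a) (w := x)
    rw [dist_eq_one_iff_adj.mpr hwa] at this
    rw [Walk.length_cons] at hp
    rw [mem_branch]
    omega

lemma exists_dist_eq_and_dist_eq (hG : G.Connected) {u v : V} {k : ℕ} (hk : k ≤ G.dist u v) :
    ∃ w, G.dist u w = k ∧ G.dist w v = G.dist u v - k := by
  obtain ⟨p, hp⟩ := hG.exists_walk_length_eq_dist u v
  have hu : G.dist u (p.getVert k) ≤ k := (dist_le (p.take k)).trans (by simp)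
  have hv : G.dist (p.getVert k) v ≤ G.dist u v - k :=
    (dist_le (p.drop k)).trans (by simp [hp])
  have := hG.dist_triangle (u := u) (v := p.getVert k) (w := v)
  exact ⟨p.getVert k, by omega, by omega⟩

lemma mem_branch_or_mem_branch (hG : G.IsTree) (hab : G.Adj a b) (x : V) :
    x ∈ branch G a b ∨ x ∈ branch G b a := by
  have := hG.dist_eq_dist_add_one_of_adj x hab
  rwa [G.dist_comm (u := x), G.dist_comm (u := x)] at this

lemma eq_of_mem_branch (hG : G.IsTree) (hwa : G.Adj w a) (hwb : G.Adj w b)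
    (ha : x ∈ branch G w a) (hb : x ∈ branch G w b) : a = b := by
  obtain ⟨p, hp⟩ := hG.connected.exists_walk_length_eq_dist a x
  obtain ⟨q, hq⟩ := hG.connected.exists_walk_length_eq_dist b x
  have hp' : (p.cons hwa).IsPath :=
    Walk.isPath_of_length_eq_dist _ (by rw [Walk.length_cons, hp, mem_branch.mp ha])
  have hq' : (q.cons hwb).IsPath :=
    Walk.isPath_of_length_eq_dist _ (by rw [Walk.length_cons, hq, mem_branch.mp hb])
  simpa using congrArg Walk.snd ((hG.existsUnique_path w x).unique hp' hq')

lemma dist_eq_of_mem_branch (hG : G.IsTree) (hab : G.Adj a b) (hx : x ∈ branch G b a)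
    (hy : y ∈ branch G a b) : G.dist x y = G.dist a x + 1 + G.dist b y := by
  obtain ⟨p, hp⟩ := hG.connected.exists_walk_length_eq_dist x a
  obtain ⟨q, hq⟩ := hG.connected.exists_walk_length_eq_dist b y
  have hp' : (p.concat hab).IsPath := Walk.isPath_of_length_eq_dist _
    (by rw [Walk.length_concat, hp, dist_comm, dist_comm (u := x), mem_branch.mp hx])
  have hq' : (q.cons hab).IsPath :=
    Walk.isPath_of_length_eq_dist _ (by rw [Walk.length_cons, hq, mem_branch.mp hy])
  have hpq : (p.append (q.cons hab)).IsPath := by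
    rw [hG.isAcyclic.isPath_iff_isChain] at hp' hq' ⊢
    rw [Walk.edges_append, Walk.edges_cons, List.isChain_split]
    exact ⟨by simpa using hp', hq'⟩
  have hlen := length_eq_dist_of_two_mul_length_lt_egirth hpq
    (egirth_eq_top.mpr hG.isAcyclic ▸ ENat.natCast_lt_top _)
  rw [Walk.length_append, Walk.length_cons, hp, hq, dist_comm] at hlen
  omega

lemma dist_lt_dist_of_mem_branch (hG : G.IsTree) (hwa : G.Adj w a) (hu : u ∈ branch G w a)
    (hx : x ∈ branch G w a) (hv : v ∉ branch G w a) (hdist : G.dist w u ≤ G.dist w v + 1) :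
    G.dist u x < G.dist v x := by
  have hv' := (mem_branch_or_mem_branch hG hwa v).resolve_left hv
  have hvx := dist_eq_of_mem_branch hG hwa.symm hx hv'
  have := hG.connected.dist_triangle (u := u) (v := a) (w := x)
  rw [dist_comm] at hvx
  rw [dist_comm (u := u) (v := a)] at this
  rw [mem_branch] at hu
  omega

/-- The two branches at a middle vertex `w` of the path from `u` to `v` that contain `u` and `v`
consist of vertices resolving them. -/
theorem isNonlocalResolvingSet_iff_of_isTree (hG : G.IsTree) {X : Finset V} :
    G.IsNonlocalResolvingSet X ↔ ∀ w a b, G.Adj w a → G.Adj w b → a ≠ b →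
      ∃ x ∈ X, x ∈ branch G w a ∨ x ∈ branch G w b := by
  refine ⟨fun hX w a b hwa hwb hab => ?_, fun h u v huv hadj => ?_⟩
  · have hnadj : ¬ G.Adj a b := fun hadj => hG.dist_ne_of_adj w hadj
      (by rw [dist_eq_one_iff_adj.mpr hwa, dist_eq_one_iff_adj.mpr hwb])
    obtain ⟨x, hx, hne⟩ := hX a b hab hnadj
    refine ⟨x, hx, by_contra fun hcon => hne ?_⟩
    push Not at hcon
    have ha := (mem_branch_or_mem_branch hG hwa x).resolve_left hcon.1
    have hb := (mem_branch_or_mem_branch hG hwb x).resolve_left hcon.2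
    rw [mem_branch.mp ha, mem_branch.mp hb]
  · have htwo : 2 ≤ G.dist u v := hG.connected.one_lt_dist_of_ne_of_not_adj huv hadj
    obtain ⟨w, hu, hv⟩ := exists_dist_eq_and_dist_eq hG.connected (Nat.div_le_self (G.dist u v) 2)
    rw [dist_comm] at hu
    have hwu : w ≠ u := by rintro rfl; rw [dist_self] at hu; omega
    have hwv : w ≠ v := by rintro rfl; rw [dist_self] at hv; omega
    obtain ⟨a, hwa, hua⟩ := exists_adj_mem_branch hG.connected hwu
    obtain ⟨b, hwb, hvb⟩ := exists_adj_mem_branch hG.connected hwv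
    have hab : a ≠ b := fun hab => by
      have := hG.connected.dist_triangle (u := u) (v := a) (w := v)
      rw [mem_branch] at hua hvb
      rw [← hab] at hvb
      rw [dist_comm (u := u) (v := a)] at this
      omega
    obtain ⟨x, hx, hxa | hxb⟩ := h w a b hwa hwb hab
    · exact ⟨x, hx, (dist_lt_dist_of_mem_branch hG hwa hua hxa
        (fun hva => hab (eq_of_mem_branch hG hwa hwb hva hvb)) (by omega)).ne⟩
    · exact ⟨x, hx, (dist_lt_dist_of_mem_branch hG hwb hvb hxb
        (fun hub => hab (eq_of_mem_branch hG hwa hwb hua hub)) (by omega)).ne'⟩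

lemma degree_le_card_add_one_of_isTree (hG : G.IsTree) {X : Finset V}
    (hX : G.IsNonlocalResolvingSet X) (c : V) [Fintype (G.neighborSet c)] :
    G.degree c ≤ X.card + 1 := by
  classical
  have hmeet : {a ∈ G.neighborFinset c | ∃ x ∈ X, x ∈ branch G c a}.card ≤ X.card := by
    have hex : ∀ a ∈ {a ∈ G.neighborFinset c | ∃ x ∈ X, x ∈ branch G c a},
        G.Adj c a ∧ ∃ x ∈ X, x ∈ branch G c a := fun a ha => by
      simpa only [Finset.mem_filter, mem_neighborFinset] using ha
    choose! hadj f hfX hf using hex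
    exact Finset.card_le_card_of_injOn f hfX fun a ha b hb hab =>
      eq_of_mem_branch hG (hadj a ha) (hadj b hb) (hf a ha) (hab ▸ hf b hb)
  have hmiss : ({a ∈ G.neighborFinset c | ¬ ∃ x ∈ X, x ∈ branch G c a}).card ≤ 1 := by
    refine Finset.card_le_one.mpr fun a ha b hb => by_contra fun hab => ?_
    rw [Finset.mem_filter, mem_neighborFinset] at ha hb
    obtain ⟨x, hx, hxa | hxb⟩ :=
      (isNonlocalResolvingSet_iff_of_isTree hG).mp hX c a b ha.1 hb.1 hab
    · exact ha.2 ⟨x, hx, hxa⟩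
    · exact hb.2 ⟨x, hx, hxb⟩
  rw [← card_neighborFinset_eq_degree, ← Finset.card_filter_add_card_filter_not
    (fun a => ∃ x ∈ X, x ∈ branch G c a)]
  omega

/-- Having at most one neighbour. In a connected graph with at least two vertices these are the
vertices of degree one. -/
def IsEndVertex (G : SimpleGraph V) (x : V) : Prop :=
  (G.neighborSet x).Subsingleton

/-- Having at least three neighbours, encoded as: no two vertices exhaust the neighbours. -/
def IsMajorVertex (G : SimpleGraph V) (x : V) : Prop :=
  ∀ a b, ∃ y, G.Adj x y ∧ y ≠ a ∧ y ≠ b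

lemma IsMajorVertex.not_isEndVertex (hx : IsMajorVertex G x) : ¬ IsEndVertex G x := fun hend => by
  obtain ⟨y, hxy, -⟩ := hx x x
  obtain ⟨z, hxz, hzy, -⟩ := hx y y
  exact hzy (hend hxz hxy)

lemma branch_subset_branch (hG : G.IsTree) (hwa : G.Adj w a) (hs : s ∈ branch G w a)
    (hsy : G.Adj s y) (hw : w ∉ branch G s y) : branch G s y ⊆ branch G w a := fun x hx => by
  have hwx := dist_eq_of_mem_branch hG hsy
    ((mem_branch_or_mem_branch hG hsy w).resolve_left hw) hx
  have hax := hG.connected.dist_triangle (u := a) (v := s) (w := x)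
  refine (mem_branch_or_mem_branch hG hwa x).resolve_right fun hx' => ?_
  rw [mem_branch] at hs hx hx'
  rw [G.dist_comm] at hs
  omega

lemma exists_isEndVertex_mem_branch [Finite V] (hG : G.IsTree) (hwa : G.Adj w a) :
    ∃ x ∈ branch G w a, IsEndVertex G x := by
  obtain ⟨x, hx, hmax⟩ := (branch G w a).toFinite.exists_maximalFor (G.dist w) _
    ⟨a, mem_branch_self hwa⟩
  have hcloser : ∀ y, G.Adj x y → w ∈ branch G x y := fun y hxy => by
    by_contra hw
    have hy : y ∈ branch G w a := branch_subset_branch hG hwa hx hxy hw (mem_branch_self hxy)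
    have hwy := mem_branch.mp ((mem_branch_or_mem_branch hG hxy w).resolve_left hw)
    rw [G.dist_comm, G.dist_comm (u := x)] at hwy
    have := hmax hy (by omega)
    omega
  exact ⟨x, hx, fun y hxy z hxz => eq_of_mem_branch hG hxy hxz (hcloser y hxy) (hcloser z hxz)⟩

lemma isNonlocalResolvingSet_of_forall_isEndVertex_mem [Finite V] (hG : G.IsTree) {X : Finset V}
    {z : V} (hX : ∀ x, IsEndVertex G x → x ≠ z → x ∈ X) : G.IsNonlocalResolvingSet X := by
  refine (isNonlocalResolvingSet_iff_of_isTree hG).mpr fun w a b hwa hwb hab => ?_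
  obtain ⟨x, hxa, hx⟩ := exists_isEndVertex_mem_branch hG hwa
  obtain ⟨y, hyb, hy⟩ := exists_isEndVertex_mem_branch hG hwb
  by_cases hxz : x = z
  · have hyz : y ≠ z := fun hyz =>
      hab (eq_of_mem_branch hG hwa hwb hxa (hxz.trans hyz.symm ▸ hyb))
    exact ⟨y, hX y hy hyz, Or.inr hyb⟩
  · exact ⟨x, hX x hx hxz, Or.inl hxa⟩

/-- A branch with a single end vertex `z` is a path, which no major vertex can enter. -/
lemma eq_of_forall_isEndVertex_mem_branch [Finite V] (hG : G.IsTree) (hwa : G.Adj w a)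
    (hz : ∀ x ∈ branch G w a, IsEndVertex G x → x = z) (hsz : G.Adj s z)
    (hs : IsMajorVertex G s) : w = s := by
  have hza : z ∈ branch G w a := by
    obtain ⟨x, hxa, hx⟩ := exists_isEndVertex_mem_branch hG hwa
    exact hz x hxa hx ▸ hxa
  by_cases hsa : s ∈ branch G w a
  · have hsw : s ≠ w := by
      rintro rfl
      simp [mem_branch] at hsa
    obtain ⟨c, hsc, hwc⟩ := exists_adj_mem_branch hG.connected hsw
    obtain ⟨y, hsy, hyz, hyc⟩ := hs z c
    have hsub := branch_subset_branch hG hwa hsa hsy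
      fun hwy => hyc (eq_of_mem_branch hG hsy hsc hwy hwc)
    obtain ⟨x, hxy, hx⟩ := exists_isEndVertex_mem_branch hG hsy
    obtain rfl := hz x (hsub hxy) hx
    exact absurd (eq_of_mem_branch hG hsy hsz hxy (mem_branch_self hsz)) hyz
  · have hdist := dist_eq_of_mem_branch hG hwa.symm hza
      ((mem_branch_or_mem_branch hG hwa s).resolve_left hsa)
    rw [dist_eq_one_iff_adj.mpr hsz.symm] at hdist
    exact (hG.connected.dist_eq_zero_iff).mp (by omega)

lemma isNonlocalResolvingSet_of_isMajorVertex [Finite V] (hG : G.IsTree) {X : Finset V}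
    {s₁ s₂ z₁ z₂ : V} (hs₁ : IsMajorVertex G s₁) (hs₂ : IsMajorVertex G s₂) (hne : s₁ ≠ s₂)
    (hz₁ : G.Adj s₁ z₁) (hz₂ : G.Adj s₂ z₂)
    (hX : ∀ x, IsEndVertex G x → x ≠ z₁ → x ≠ z₂ → x ∈ X) : G.IsNonlocalResolvingSet X := by
  refine (isNonlocalResolvingSet_iff_of_isTree hG).mpr fun w a b hwa hwb hab =>
    by_contra fun hcon => ?_
  push Not at hcon
  have hdisj : ∀ x ∈ branch G w a, x ∉ branch G w b := fun x hxa hxb =>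
    hab (eq_of_mem_branch hG hwa hwb hxa hxb)
  obtain ⟨x, hxa, hx⟩ := exists_isEndVertex_mem_branch hG hwa
  obtain ⟨y, hyb, hy⟩ := exists_isEndVertex_mem_branch hG hwb
  have hends : ∀ t, IsEndVertex G t → t ∈ branch G w a ∨ t ∈ branch G w b → t = z₁ ∨ t = z₂ := by
    intro t ht htab
    by_contra! htz
    have := hcon t (hX t ht htz.1 htz.2)
    tauto
  wlog hxz : x = z₁ generalizing a b x y
  · exact this b a hwb hwa hab.symm (fun t ht => (hcon t ht).symm)
      (fun t htb hta => hdisj t hta htb) y hyb hy x hxa hx (fun t ht htab => hends t ht htab.symm)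
      (by grind)
  have hyz : y = z₂ := by grind
  have hw₁ : w = s₁ := eq_of_forall_isEndVertex_mem_branch hG hwa (by grind) hz₁ hs₁
  have hw₂ : w = s₂ := eq_of_forall_isEndVertex_mem_branch hG hwb (by grind) hz₂ hs₂
  exact hne (hw₁.symm.trans hw₂)

/-! ### Trees attaining equality -/

lemma forall_of_preconnected (hG : G.Preconnected) {P : V → Prop} (hu : P u)
    (h : ∀ a b, P a → G.Adj a b → P b) (v : V) : P v := by
  obtain ⟨p⟩ := hG u v
  induction p with
  | nil => exact hu
  | cons hadj _ ih => exact ih (h _ _ hu hadj)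

lemma forall_isEndVertex_of_adj (hG : G.Preconnected) (hx : IsEndVertex G x)
    (hy : IsEndVertex G y) (hxy : G.Adj x y) (v : V) : IsEndVertex G v := by
  have hvxy : v = x ∨ v = y := by
    refine forall_of_preconnected hG (P := fun v => v = x ∨ v = y) (Or.inl rfl) ?_ v
    rintro a b (rfl | rfl) hab
    · exact Or.inr (hx hab hxy)
    · exact Or.inl (hy hab hxy.symm)
  rcases hvxy with rfl | rfl
  · exact hx
  · exact hy

lemma exists_injOn_of_isEdgeCoverSet {S : Finset (Sym2 V)} (hS : G.IsEdgeCoverSet S) {L : Set V}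
    (hL : G.IsIndepSet L) : ∃ g : V → Sym2 V, (∀ v, g v ∈ S ∧ v ∈ g v) ∧ Set.InjOn g L := by
  choose g hgS hg using hS.2
  refine ⟨g, fun v => ⟨hgS v, hg v⟩, fun x hx y hy hxy => by_contra fun hne => hL hx hy hne ?_⟩
  exact adj_iff_exists_edge.mpr ⟨hne, g x, hS.1 _ (hgS x), hg x, hxy ▸ hg y⟩

lemma card_le_card_of_isEdgeCoverSet {S : Finset (Sym2 V)} (hS : G.IsEdgeCoverSet S)
    {L : Finset V} (hL : G.IsIndepSet L) : L.card ≤ S.card := by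
  obtain ⟨g, hg, hinj⟩ := exists_injOn_of_isEdgeCoverSet hS hL
  exact Finset.card_le_card_of_injOn g (fun x _ => (hg x).1) hinj

lemma mem_or_exists_adj_of_card_le {S : Finset (Sym2 V)} (hS : G.IsEdgeCoverSet S)
    {L : Finset V} (hL : G.IsIndepSet L) (hcard : S.card ≤ L.card) (v : V) :
    v ∈ L ∨ ∃ x ∈ L, G.Adj v x := by
  obtain ⟨g, hg, hinj⟩ := exists_injOn_of_isEdgeCoverSet hS hL
  obtain ⟨x, hx, hxv⟩ :=
    Finset.surjOn_of_injOn_of_card_le g (fun x _ => (hg x).1) hinj hcard (hg v).1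
  by_cases hvx : v = x
  · exact Or.inl (hvx ▸ hx)
  · exact Or.inr ⟨x, hx, adj_iff_exists_edge.mpr
      ⟨hvx, g v, hS.1 _ (hg v).1, (hg v).2, hxv ▸ (hg x).2⟩⟩

lemma exists_isEndVertex [Finite V] [Nontrivial V] (hG : G.IsTree) : ∃ x, IsEndVertex G x := by
  obtain ⟨v⟩ := hG.connected.nonempty
  obtain ⟨a, hva⟩ := hG.connected.preconnected.exists_adj_of_nontrivial v
  obtain ⟨x, -, hx⟩ := exists_isEndVertex_mem_branch hG hva
  exact ⟨x, hx⟩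

lemma nonlocalMetricDim_add_one_le_card [Finite V] [Nontrivial V] (hG : G.IsTree) {L : Finset V}
    (hL : ∀ x, x ∈ L ↔ IsEndVertex G x) : G.nonlocalMetricDim + 1 ≤ L.card := by
  classical
  obtain ⟨z, hz⟩ := exists_isEndVertex hG
  have hX : G.IsNonlocalResolvingSet (L.erase z) :=
    isNonlocalResolvingSet_of_forall_isEndVertex_mem hG fun x hx hxz =>
      Finset.mem_erase.mpr ⟨hxz, (hL x).mpr hx⟩
  have := nonlocalMetricDim_le hX
  have := Finset.card_erase_add_one ((hL z).mpr hz)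
  omega

lemma nonlocalMetricDim_add_two_le_card [Finite V] (hG : G.IsTree) {L : Finset V}
    (hL : ∀ x, x ∈ L ↔ IsEndVertex G x) {s₁ s₂ z₁ z₂ : V} (hs₁ : IsMajorVertex G s₁)
    (hs₂ : IsMajorVertex G s₂) (hne : s₁ ≠ s₂) (hz₁ : IsEndVertex G z₁) (hz₂ : IsEndVertex G z₂)
    (hsz₁ : G.Adj s₁ z₁) (hsz₂ : G.Adj s₂ z₂) : G.nonlocalMetricDim + 2 ≤ L.card := by
  classical
  have hz : z₂ ≠ z₁ := by
    rintro rfl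
    exact hne (hz₁ hsz₁.symm hsz₂.symm)
  have hX : G.IsNonlocalResolvingSet ((L.erase z₁).erase z₂) :=
    isNonlocalResolvingSet_of_isMajorVertex hG hs₁ hs₂ hne hsz₁ hsz₂ fun x hx hx₁ hx₂ =>
      Finset.mem_erase.mpr ⟨hx₂, Finset.mem_erase.mpr ⟨hx₁, (hL x).mpr hx⟩⟩
  have := nonlocalMetricDim_le hX
  have := Finset.card_erase_add_one (Finset.mem_erase.mpr ⟨hz, (hL z₂).mpr hz₂⟩)
  have := Finset.card_erase_add_one ((hL z₁).mpr hz₁)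
  omega

lemma isEndVertex_or_exists_adj [Finite V] [Nontrivial V] (hG : G.IsTree)
    (hle : G.edgeCoverNum ≤ G.nonlocalMetricDim + 1) (v : V) :
    IsEndVertex G v ∨ ∃ x, IsEndVertex G x ∧ G.Adj v x := by
  have hconn := hG.connected.preconnected
  by_cases hind : G.IsIndepSet {x | IsEndVertex G x}
  · obtain ⟨L, hL⟩ := {x | IsEndVertex G x}.toFinite.exists_finset
    have hLind : G.IsIndepSet L := by
      rwa [Set.ext fun x => Finset.mem_coe.trans (hL x)]
    obtain ⟨S, hS, hcard⟩ := exists_isEdgeCoverSet_card_eq hconn.exists_adj_of_nontrivial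
    have := nonlocalMetricDim_add_one_le_card hG hL
    simpa only [hL, Set.mem_ofPred_eq] using mem_or_exists_adj_of_card_le hS hLind (by omega) v
  · simp only [isIndepSet_iff, Set.Pairwise] at hind
    push Not at hind
    obtain ⟨x, hx, y, hy, -, hxy⟩ := hind
    exact Or.inl (forall_isEndVertex_of_adj hconn hx hy hxy v)

lemma eq_of_isMajorVertex [Finite V] [Nontrivial V] (hG : G.IsTree)
    (hle : G.edgeCoverNum ≤ G.nonlocalMetricDim + 1) {s₁ s₂ : V} (hs₁ : IsMajorVertex G s₁)
    (hs₂ : IsMajorVertex G s₂) : s₁ = s₂ := by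
  have hconn := hG.connected.preconnected
  by_contra hne
  have hend := isEndVertex_or_exists_adj hG hle
  obtain ⟨z₁, hz₁, hsz₁⟩ := (hend s₁).resolve_left hs₁.not_isEndVertex
  obtain ⟨z₂, hz₂, hsz₂⟩ := (hend s₂).resolve_left hs₂.not_isEndVertex
  obtain ⟨L, hL⟩ := {x | IsEndVertex G x}.toFinite.exists_finset
  obtain ⟨S, hS, hcard⟩ := exists_isEdgeCoverSet_card_eq hconn.exists_adj_of_nontrivial
  have hind : G.IsIndepSet L := fun x hx y hy _ hxy => hs₁.not_isEndVertex <|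
    forall_isEndVertex_of_adj hconn ((hL x).mp hx) ((hL y).mp hy) hxy s₁
  have := nonlocalMetricDim_add_two_le_card hG hL hs₁ hs₂ hne hz₁ hz₂ hsz₁ hsz₂
  have := card_le_card_of_isEdgeCoverSet hS hind
  omega

/-- `t` is the tip of the leg of length one or two that starts at `c` with the edge `ca`: either
`t = a`, or the leg is the path `c, a, t`. -/
structure IsTip (G : SimpleGraph V) (c a t : V) : Prop where
  ne : t ≠ c
  isEndVertex : IsEndVertex G t
  eq_or_adj : t = a ∨ G.Adj a t
  neighborSet_subset : G.neighborSet a ⊆ {c, t}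

lemma exists_center [Nontrivial V] (hG : G.Connected)
    (hend : ∀ v, IsEndVertex G v ∨ ∃ x, IsEndVertex G x ∧ G.Adj v x)
    (hmajor : ∀ s₁ s₂, IsMajorVertex G s₁ → IsMajorVertex G s₂ → s₁ = s₂) :
    ∃ c, (∃ x, IsEndVertex G x ∧ G.Adj c x) ∧ ∀ v, v ≠ c → ¬ IsMajorVertex G v := by
  by_cases h : ∃ c, IsMajorVertex G c
  · obtain ⟨c, hc⟩ := h
    exact ⟨c, (hend c).resolve_left hc.not_isEndVertex, fun v hv hv' => hv (hmajor v c hv' hc)⟩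
  · push Not at h
    obtain ⟨v⟩ := hG.nonempty
    rcases hend v with hv | hv
    · obtain ⟨c, hc⟩ := hG.preconnected.exists_adj_of_nontrivial v
      exact ⟨c, ⟨v, hv, hc.symm⟩, fun u _ => h u⟩
    · exact ⟨v, hv, fun u _ => h u⟩

lemma exists_isTip (hend : ∀ v, IsEndVertex G v ∨ ∃ x, IsEndVertex G x ∧ G.Adj v x) {x₀ : V}
    (hx₀ : IsEndVertex G x₀) (hcx₀ : G.Adj c x₀) (hca : G.Adj c a) (ha : ¬ IsMajorVertex G a) :
    ∃ t, IsTip G c a t := by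
  by_cases haend : IsEndVertex G a
  · exact ⟨a, hca.ne', haend, Or.inl rfl, fun y hy => Or.inl (haend hy hca.symm)⟩
  · obtain ⟨t, ht, hat⟩ := (hend a).resolve_left haend
    have htc : t ≠ c := by
      rintro rfl
      exact haend (ht hcx₀ hca ▸ hx₀)
    refine ⟨t, htc, ht, Or.inr hat, fun y hy => ?_⟩
    simp only [IsMajorVertex] at ha
    push Not at ha
    obtain ⟨p, q, hpq⟩ := ha
    have hN : ∀ w, G.Adj a w → w = p ∨ w = q := fun w hw => or_iff_not_imp_left.mpr (hpq w hw)
    rcases hN y hy with rfl | rfl <;> rcases hN t hat with rfl | rfl <;>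
      rcases hN c hca.symm with rfl | rfl <;> simp_all only [Set.mem_insert_iff,
        Set.mem_singleton_iff, ne_eq, not_true_eq_false, or_true, true_or]

lemma IsTip.eq_of_adj (h : IsTip G c a x) (hca : G.Adj c a) (hcx : G.Adj c x) : x = a :=
  h.eq_or_adj.resolve_right fun hax => hca.ne (h.isEndVertex hcx.symm hax.symm)

lemma IsTip.eq_of_isTip (ha : IsTip G c a x) (hb : IsTip G c b x) (hca : G.Adj c a)
    (hcb : G.Adj c b) : a = b := by
  rcases ha.eq_or_adj with rfl | hax
  · exact hb.eq_of_adj hcb hca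
  rcases hb.eq_or_adj with rfl | hbx
  · exact (ha.eq_of_adj hca hcb).symm
  exact ha.isEndVertex hax.symm hbx.symm

lemma eq_or_exists_of_isTip (hG : G.Preconnected) {ι : Type*} {n t : ι → V}
    (hcn : ∀ a, G.Adj c a → ∃ i, n i = a) (ht : ∀ i, IsTip G c (n i) (t i)) (v : V) :
    v = c ∨ ∃ i, v = n i ∨ v = t i := by
  refine forall_of_preconnected hG (P := fun v => v = c ∨ ∃ i, v = n i ∨ v = t i) (Or.inl rfl) ?_ v
  rintro x y (rfl | ⟨i, hx⟩) hxy
  · obtain ⟨i, rfl⟩ := hcn y hxy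
    exact Or.inr ⟨i, Or.inl rfl⟩
  · by_cases hxn : x = n i
    · rcases (ht i).neighborSet_subset (hxn ▸ hxy) with hy | hy
      · exact Or.inl hy
      · exact Or.inr ⟨i, Or.inr hy⟩
    · obtain rfl := hx.resolve_left hxn
      have hnt := (ht i).eq_or_adj.resolve_left hxn
      exact Or.inr ⟨i, Or.inl ((ht i).isEndVertex hxy hnt.symm)⟩

lemma adj_of_adj_map {W : Type*} {H : SimpleGraph W} (hH : H.Preconnected) (hG : G.IsAcyclic)
    (f : H →g G) (hf : Function.Injective f) {u v : W} (h : G.Adj (f u) (f v)) : H.Adj u v := by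
  classical
  obtain ⟨p, hp⟩ := (hH u v).exists_isPath
  have hlen := length_eq_dist_of_two_mul_length_lt_egirth (hp.map hf)
    (egirth_eq_top.mpr hG ▸ ENat.natCast_lt_top _)
  rw [Walk.length_map, dist_eq_one_iff_adj.mpr h] at hlen
  exact Walk.adj_of_length_eq_one hlen

lemma preconnected_subdivide {W : Type*} {H : SimpleGraph W} (hH : H.Preconnected)
    (F : Set (Sym2 W)) : (H.subdivide F).Preconnected := by
  have hinl : ∀ u v : W, (H.subdivide F).Reachable (.inl u) (.inl v) := fun u v => by
    refine forall_of_preconnected hH (P := fun v => (H.subdivide F).Reachable (.inl u) (.inl v))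
      .rfl (fun a b hua hab => hua.trans ?_) v
    by_cases hF : s(a, b) ∈ F
    · have ha : (H.subdivide F).Adj (.inl a) (.inr ⟨s(a, b), hF, hab⟩) := Sym2.mem_mk_left a b
      have hb : (H.subdivide F).Adj (.inr ⟨s(a, b), hF, hab⟩) (.inl b) := Sym2.mem_mk_right a b
      exact ha.reachable.trans hb.reachable
    · exact Adj.reachable (G := H.subdivide F) ⟨hab, hF⟩
  have hbase : ∀ x, ∃ u, (H.subdivide F).Reachable x (.inl u) := by
    rintro (u | e)
    · exact ⟨u, .rfl⟩
    · exact ⟨_, Adj.reachable (G := H.subdivide F) (u := .inr e) e.1.out_fst_mem⟩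
  intro x y
  obtain ⟨⟨u, hu⟩, v, hv⟩ := And.intro (hbase x) (hbase y)
  exact hu.trans ((hinl u v).trans hv.symm)

/-! ### Subdivided stars -/

lemma adj_starGraph_zero_succ {m : ℕ} (i : Fin m) :
    (starGraph (0 : Fin (m + 1))).Adj 0 i.succ := by
  simp [starGraph_adj, (Fin.succ_ne_zero i).symm]

lemma mem_edgeSet_starGraph_zero {m : ℕ} {e : Sym2 (Fin (m + 1))} :
    e ∈ (starGraph (0 : Fin (m + 1))).edgeSet ↔ ∃ i : Fin m, e = s(0, i.succ) := by
  constructor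
  · induction e with | _ u v
    intro h
    rw [mem_edgeSet, starGraph_adj] at h
    obtain ⟨hne, rfl | rfl⟩ := h
    · obtain ⟨i, rfl⟩ := Fin.exists_succ_eq.mpr hne.symm
      exact ⟨i, rfl⟩
    · obtain ⟨i, rfl⟩ := Fin.exists_succ_eq.mpr hne
      exact ⟨i, Sym2.eq_swap⟩
  · rintro ⟨i, rfl⟩
    exact adj_starGraph_zero_succ i

/-- The index `i` such that the given edge of the star with centre `0` is `s(0, i.succ)`. -/
noncomputable def legIndex {m : ℕ} {F : Set (Sym2 (Fin (m + 1)))}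
    (e : {e // e ∈ F ∧ e ∈ (starGraph (0 : Fin (m + 1))).edgeSet}) : Fin m :=
  (mem_edgeSet_starGraph_zero.mp e.2.2).choose

/-- The map sending a subdivided star to the graph with centre `c` and legs `c, n i, t i`: the
leaves of the star go to the tips, and the subdivision vertices to the vertices next to `c`. -/
noncomputable def legMap {m : ℕ} (F : Set (Sym2 (Fin (m + 1)))) (c : V) (n t : Fin m → V) :
    Fin (m + 1) ⊕ {e // e ∈ F ∧ e ∈ (starGraph (0 : Fin (m + 1))).edgeSet} → V :=
  Sum.elim (Fin.cons c t) (n ∘ legIndex)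

section LegMap

variable {m : ℕ} {n t : Fin m → V} {F : Set (Sym2 (Fin (m + 1)))}

lemma coe_eq_legIndex (e : {e // e ∈ F ∧ e ∈ (starGraph (0 : Fin (m + 1))).edgeSet}) :
    e.1 = s(0, (legIndex e).succ) :=
  (mem_edgeSet_starGraph_zero.mp e.2.2).choose_spec

lemma adj_legMap (hcn : ∀ i, G.Adj c (n i)) (ht : ∀ i, IsTip G c (n i) (t i))
    (hF : ∀ i, s(0, i.succ) ∈ F ↔ t i ≠ n i)
    {x y : Fin (m + 1) ⊕ {e // e ∈ F ∧ e ∈ (starGraph (0 : Fin (m + 1))).edgeSet}}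
    (hxy : ((starGraph 0).subdivide F).Adj x y) :
    G.Adj (legMap F c n t x) (legMap F c n t y) := by
  have hinr : ∀ u e, u ∈ e.1 → G.Adj (legMap F c n t (.inl u)) (legMap F c n t (.inr e)) := by
    intro u e hu
    have he := e.2.1
    rw [coe_eq_legIndex e, hF] at he
    rw [coe_eq_legIndex e, Sym2.mem_iff] at hu
    rcases hu with rfl | rfl
    · exact hcn (legIndex e)
    · exact ((ht (legIndex e)).eq_or_adj.resolve_left he).symm
  rcases x with u | e <;> rcases y with v | e'
  · obtain ⟨i, hi⟩ := mem_edgeSet_starGraph_zero.mp ((mem_edgeSet _).mpr hxy.1)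
    have hti : t i = n i := not_not.mp ((hF i).not.mp (hi ▸ hxy.2))
    have hct : G.Adj c (t i) := hti ▸ hcn i
    rcases Sym2.eq_iff.mp hi with ⟨rfl, rfl⟩ | ⟨rfl, rfl⟩
    · exact hct
    · exact hct.symm
  · exact hinr u e' hxy
  · exact (hinr v e hxy).symm
  · exact hxy.elim

lemma injective_legMap (hn : Function.Injective n) (hcn : ∀ i, G.Adj c (n i))
    (ht : ∀ i, IsTip G c (n i) (t i)) (hF : ∀ i, s(0, i.succ) ∈ F ↔ t i ≠ n i) :
    Function.Injective (legMap F c n t) := by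
  have htinj : Function.Injective t := fun i j hij =>
    hn ((ht i).eq_of_isTip (hij ▸ ht j) (hcn i) (hcn j))
  have hindex : Function.Injective (legIndex (F := F)) := fun e e' h =>
    Subtype.ext (by rw [coe_eq_legIndex e, coe_eq_legIndex e', h])
  refine (Fin.cons_injective_iff.mpr ⟨fun ⟨i, hi⟩ => (ht i).ne hi, htinj⟩).sumElim
    (hn.comp hindex) fun u e => ?_
  induction u using Fin.cases with
  | zero => exact (hcn _).ne
  | succ i =>
    intro (h : t i = n (legIndex e))
    have hti : t i = n i := (ht i).eq_of_adj (hcn i) (h ▸ hcn _)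
    have hi : i = legIndex e := hn (hti.symm.trans h)
    have he := e.2.1
    rw [coe_eq_legIndex e, hF, ← hi] at he
    exact he hti

lemma surjective_legMap (hG : G.Preconnected) (hcn : ∀ a, G.Adj c a → ∃ i, n i = a)
    (ht : ∀ i, IsTip G c (n i) (t i)) (hF : ∀ i, s(0, i.succ) ∈ F ↔ t i ≠ n i) :
    Function.Surjective (legMap F c n t) := by
  intro v
  rcases eq_or_exists_of_isTip hG hcn ht v with rfl | ⟨i, rfl | rfl⟩
  · exact ⟨.inl 0, rfl⟩
  · by_cases hi : t i = n i
    · exact ⟨.inl i.succ, hi⟩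
    · let e : {e // e ∈ F ∧ e ∈ (starGraph (0 : Fin (m + 1))).edgeSet} :=
        ⟨s(0, i.succ), (hF i).mpr hi, adj_starGraph_zero_succ i⟩
      have he : legIndex e = i :=
        (Fin.succ_injective _ (Sym2.congr_right.mp (coe_eq_legIndex e))).symm
      exact ⟨.inr e, congrArg n he⟩
  · exact ⟨.inl i.succ, rfl⟩

lemma nonempty_iso_of_isTip (hG : G.IsTree) (hn : Function.Injective n)
    (hcn : ∀ a, G.Adj c a ↔ ∃ i, n i = a) (ht : ∀ i, IsTip G c (n i) (t i))
    (hF : ∀ i, s(0, i.succ) ∈ F ↔ t i ≠ n i) :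
    Nonempty (G ≃g (starGraph (0 : Fin (m + 1))).subdivide F) := by
  have hadj : ∀ i, G.Adj c (n i) := fun i => (hcn _).mpr ⟨i, rfl⟩
  let φ : (starGraph (0 : Fin (m + 1))).subdivide F →g G :=
    ⟨legMap F c n t, adj_legMap hadj ht hF⟩
  have hφ : Function.Injective φ := injective_legMap hn hadj ht hF
  have hφ' : Function.Surjective φ :=
    surjective_legMap hG.connected.preconnected (fun a => (hcn a).mp) ht hF
  have hpre := preconnected_subdivide (connected_starGraph (0 : Fin (m + 1))).preconnected F
  exact ⟨.symm ⟨Equiv.ofBijective φ ⟨hφ, hφ'⟩,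
    ⟨adj_of_adj_map hpre hG.isAcyclic φ hφ, φ.map_rel⟩⟩⟩

end LegMap

lemma isStarSubdividedAllButOneAtMostOnce_of_isTip [Finite V] (hG : G.IsTree)
    (hx : IsEndVertex G x) (hcx : G.Adj c x)
    (htip : ∀ a, G.Adj c a → ∃ t, IsTip G c a t) : G.IsStarSubdividedAllButOneAtMostOnce := by
  have : Nonempty V := ⟨c⟩
  choose! T hT using htip
  let n := (Finite.equivFin (G.neighborSet c)).symm
  obtain ⟨i₀, hi₀⟩ := n.surjective ⟨x, hcx⟩
  have hTx : T x = x := 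
    (hT x hcx).eq_or_adj.resolve_right fun h => (hT x hcx).ne (hx h hcx.symm)
  let F : Set (Sym2 (Fin (Nat.card (G.neighborSet c) + 1))) :=
    (fun i => s(0, i.succ)) '' {i | T (n i) ≠ n i}
  have hinj : Function.Injective fun i : Fin (Nat.card (G.neighborSet c)) =>
      s(0, i.succ) := fun i j hij => Fin.succ_injective _ (Sym2.congr_right.mp hij)
  refine ⟨_, s(0, i₀.succ), F, adj_starGraph_zero_succ i₀, ?_, ?_⟩
  · rintro _ ⟨i, hi, rfl⟩
    refine ⟨adj_starGraph_zero_succ i, fun h => hi ?_⟩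
    rw [hinj h, hi₀, hTx]
  · exact nonempty_iso_of_isTip hG (Subtype.val_injective.comp n.injective)
      (fun a => ⟨fun ha => ⟨n.symm ⟨a, ha⟩, congrArg Subtype.val (n.apply_symm_apply _)⟩,
        fun ⟨i, hi⟩ => hi ▸ (n i).2⟩)
      (fun i => hT _ (n i).2) fun i => hinj.mem_set_image

section Towards

variable {W : Type*} {H : SimpleGraph W} {u v w : W}

open Classical in
/-- The first vertex after `u` on the way from `u` to `v` in the subdivision of `H`: the new vertex
on the edge `uv` if it is subdivided, and `v` otherwise. -/
noncomputable def towards (F : Set (Sym2 W)) (h : H.Adj u v) :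
    W ⊕ {e : Sym2 W // e ∈ F ∧ e ∈ H.edgeSet} :=
  if hF : s(u, v) ∈ F then .inr ⟨s(u, v), hF, h⟩ else .inl v

lemma adj_towards (F : Set (Sym2 W)) (h : H.Adj u v) :
    (H.subdivide F).Adj (.inl u) (towards F h) := by
  unfold towards
  split_ifs with hF
  · exact Sym2.mem_mk_left u v
  · exact ⟨h, hF⟩

lemma eq_of_towards_eq {F : Set (Sym2 W)} (hv : H.Adj u v) (hw : H.Adj u w)
    (h : towards F hv = towards F hw) : v = w := by
  unfold towards at h
  split_ifs at h
  · exact Sym2.congr_right.mp (congrArg Subtype.val (Sum.inr_injective h))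
  · exact Sum.inl_injective h

lemma degree_le_degree_subdivide (F : Set (Sym2 W)) (u : W) [Fintype (H.neighborSet u)]
    [Fintype ((H.subdivide F).neighborSet (.inl u))] :
    H.degree u ≤ (H.subdivide F).degree (.inl u) := by
  rw [← card_neighborSet_eq_degree, ← card_neighborSet_eq_degree]
  exact Fintype.card_le_of_injective
    (fun v : H.neighborSet u => ⟨towards F v.2, adj_towards F v.2⟩)
    fun v w h => Subtype.ext (eq_of_towards_eq v.2 w.2 (congrArg Subtype.val h))

end Towards

lemma isEdgeCoverSet_image {W : Type*} [DecidableEq W] {H : SimpleGraph W} {S : Finset (Sym2 V)}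
    (hS : G.IsEdgeCoverSet S) (f : G →g H) (hf : Function.Surjective f) :
    H.IsEdgeCoverSet (S.image (Sym2.map f)) := by
  refine ⟨fun e he => ?_, fun w => ?_⟩
  · obtain ⟨e, heS, rfl⟩ := Finset.mem_image.mp he
    exact f.map_mem_edgeSet (hS.1 e heS)
  · obtain ⟨v, rfl⟩ := hf w
    obtain ⟨e, heS, hve⟩ := hS.2 v
    exact ⟨_, Finset.mem_image_of_mem _ heS, Sym2.mem_map.mpr ⟨v, hve, rfl⟩⟩

lemma edgeCoverNum_le_of_surjective {W : Type*} {H : SimpleGraph W} {S : Finset (Sym2 V)}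
    (hS : G.IsEdgeCoverSet S) (f : G →g H) (hf : Function.Surjective f) :
    H.edgeCoverNum ≤ S.card := by
  classical
  exact (edgeCoverNum_le (isEdgeCoverSet_image hS f hf)).trans Finset.card_image_le

lemma exists_isEdgeCoverSet_subdivide_starGraph {m : ℕ} {F : Set (Sym2 (Fin (m + 1)))}
    {i₀ : Fin m} (hi₀ : s(0, i₀.succ) ∉ F) :
    ∃ S, ((starGraph 0).subdivide F).IsEdgeCoverSet S ∧ S.card ≤ m := by
  classical
  let e (i : Fin m) := s(.inl i.succ, towards F (adj_starGraph_zero_succ i).symm)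
  refine ⟨Finset.univ.image e, ⟨fun e' he' => ?_, fun v => ?_⟩,
    Finset.card_image_le.trans_eq (Finset.card_fin m)⟩
  · obtain ⟨i, -, rfl⟩ := Finset.mem_image.mp he'
    exact adj_towards F (adj_starGraph_zero_succ i).symm
  · suffices h : ∃ i, v ∈ e i by
      obtain ⟨i, hi⟩ := h
      exact ⟨e i, Finset.mem_image_of_mem e (Finset.mem_univ i), hi⟩
    rcases v with u | f
    · induction u using Fin.cases with
      | zero => exact ⟨i₀, by simp [e, towards, Sym2.eq_swap (a := i₀.succ), hi₀]⟩
      | succ i => exact ⟨i, Sym2.mem_mk_left _ _⟩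
    · obtain ⟨f, hfF, hf⟩ := f
      obtain ⟨i, rfl⟩ := mem_edgeSet_starGraph_zero.mp hf
      exact ⟨i, by simp [e, towards, Sym2.eq_swap (a := i.succ), hfF]⟩

lemma edgeCoverNum_le_of_isStarSubdividedAllButOneAtMostOnce (hG : G.IsTree)
    (h : G.IsStarSubdividedAllButOneAtMostOnce) :
    G.edgeCoverNum ≤ G.nonlocalMetricDim + 1 := by
  classical
  obtain ⟨m, e₀, F, he₀, hF, ⟨φ⟩⟩ := h
  obtain ⟨i₀, rfl⟩ := mem_edgeSet_starGraph_zero.mp he₀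
  have : Finite V := .of_equiv _ φ.symm.toEquiv
  have := Fintype.ofFinite V
  obtain ⟨S, hS, hSm⟩ :=
    exists_isEdgeCoverSet_subdivide_starGraph fun h : s(0, i₀.succ) ∈ F => (hF h).2 rfl
  obtain ⟨X, hX, hcard⟩ := exists_isNonlocalResolvingSet_card_eq hG.connected
  calc G.edgeCoverNum ≤ S.card := edgeCoverNum_le_of_surjective hS φ.symm.toHom φ.symm.surjective
    _ ≤ (starGraph (0 : Fin (m + 1))).degree 0 := by
      rwa [degree_starGraph_center, Fintype.card_fin]
    _ ≤ ((starGraph 0).subdivide F).degree (.inl 0) := degree_le_degree_subdivide F 0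
    _ = G.degree (φ.symm (.inl 0)) := (φ.symm.degree_eq _).symm
    _ ≤ X.card + 1 := degree_le_card_add_one_of_isTree hG hX _
    _ = G.nonlocalMetricDim + 1 := by rw [hcard]

end NonlocalMetricDim

theorem mainTheorem5 {V : Type*} [Finite V] [Nontrivial V] (G : SimpleGraph V)
    (hconn : G.Connected) (hgirth : 7 ≤ G.egirth) :
    (G.nonlocalMetricDim : ℤ) ≤ (G.edgeCoverNum : ℤ) - 1 ∧
      (G.IsTree →
        ((G.nonlocalMetricDim : ℤ) = (G.edgeCoverNum : ℤ) - 1 ↔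
          G.IsStarSubdividedAllButOneAtMostOnce)) := by
  have hle := NonlocalMetricDim.nonlocalMetricDim_add_one_le_edgeCoverNum hconn
    (lt_of_lt_of_le (by norm_num) hgirth)
  refine ⟨by omega, fun hG => ⟨fun h => ?_, fun h => ?_⟩⟩
  · have hle' : G.edgeCoverNum ≤ G.nonlocalMetricDim + 1 := by omega
    have hend := NonlocalMetricDim.isEndVertex_or_exists_adj hG hle'
    obtain ⟨c, ⟨x, hx, hcx⟩, hc⟩ := NonlocalMetricDim.exists_center hconn hend
      fun _ _ => NonlocalMetricDim.eq_of_isMajorVertex hG hle'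
    exact NonlocalMetricDim.isStarSubdividedAllButOneAtMostOnce_of_isTip hG hx hcx fun a hca =>
      NonlocalMetricDim.exists_isTip hend hx hcx hca (hc a hca.ne')
  · have := NonlocalMetricDim.edgeCoverNum_le_of_isStarSubdividedAllButOneAtMostOnce hG h
    omega
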